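/- Let $p\in[1,2]$, $\alpha>2$, $\beta>0$, and let $J:\mathbb N\to\mathbb R$ satisfy $J(k)=O(k^{-\alpha})$ as $k\to\infty$ (in particular, $J(k)\sim k^{-\alpha}$ is allowed; $J$ may take either sign). For height configurations $\phi\in\mathbb Z^{\mathbb Z}$ consider the formal Hamiltonian $H(\phi)=\sum_{i\ne j\in\mathbb Z}J(|i-j|)\,|\phi_i-\phi_j|^p$. For a finite $\Lambda\subset\mathbb Z$ and $\omega\in\mathbb Z^{\mathbb Z}$ let $\mu_\Lambda^\omega$ be the probability measure on $\{\phi:\phi_i=\omega_i\ \forall i\notin\Lambda\}$ with $$\mu_\Lambda^\omega(\phi)\propto\exp\bigl(-\beta(H(\phi)-H(\omega))\bigr),\qquad H(\phi)-H(\omega):=\sum_{i\neq j}J(|i-j|)\bigl(|\phi_i-\phi_j|^p-|\omega_i-\omega_j|^p\bigr),$$ which is defined when these sums converge absolutely and the partition function is finite; $\mu^0_\Lambda$ is the case $\omega\equiv0$. A Gibbs measure is a probability measure $\mu$ on $\mathbb Z^{\mathbb Z}$ such that, for every finite $\Lambda\subset\mathbb Z$, $\mu_\Lambda^\omega$ is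 defined for $\mu$-almost every $\omega$ and $\mu=\int\mu_\Lambda^\omega\,d\mu(\omega)$. It is shift-invariant if it is invariant under all translations of $\mathbb Z$. Then there is no increasing sequence $(\Lambda_n)_n$ of finite subsets of $\mathbb Z$ with $\bigcup_n\Lambda_n=\mathbb Z$ (in particular, no such sequence of boxes, i.e. finite intervals) for which the measures $\mu^0_{\Lambda_n}$ are defined and the following two properties hold together: 1. there is a finite constant $C$ with $\langle\phi_0^2\rangle_{\mu^0_{\Lambda_n}}<C$ for every $n$; 2. $(\mu^0_{\Lambda_n})_n$ converges weakly (for the product topology on $\mathbb Z^{\mathbb Z}$) to a shift-invariant Gibbs measure. -/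

import Mathlib

open MeasureTheory Filter Topology Asymptotics

noncomputable section

namespace LongRangeSOS

/-- Height configurations `φ : ℤ → ℤ`, with the product topology and product σ-algebra. -/
abbrev Config : Type := ℤ → ℤ

/-- The potential `V(x) = |x|^p`. -/
def V (p : ℝ) (x : ℤ) : ℝ := |(x : ℝ)| ^ p

/-- The `(i, j)` term of the formal difference `H(φ) - H(ω)`, where
`H(φ) = ∑_{i ≠ j} J(|i - j|) V(φ_i - φ_j)` (sum over ordered pairs).
It vanishes when `i = j`. -/
def energyTerm (p : ℝ) (J : ℕ → ℝ) (φ ω : Config) (q : ℤ × ℤ) : ℝ :=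
  J (q.1 - q.2).natAbs * (V p (φ q.1 - φ q.2) - V p (ω q.1 - ω q.2))

/-- `H(φ) - H(ω)`. If `φ = ω` off a finite set `Λ`, only pairs that meet `Λ` contribute.
For `ω = 0` and `p ≠ 0` this is `H(φ)` itself. -/
def energyDiff (p : ℝ) (J : ℕ → ℝ) (φ ω : Config) : ℝ :=
  ∑' q : ℤ × ℤ, energyTerm p J φ ω q

/-- The configuration equal to `ψ` in `Λ` and to `ω` outside `Λ`. -/
def glue (Λ : Finset ℤ) (ψ : Λ → ℤ) (ω : Config) : Config :=
  fun i => if h : i ∈ Λ then ψ ⟨i, h⟩ else ω i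

/-- The unnormalised finite-volume measure: every `φ` that agrees with `ω` off `Λ` gets mass
`exp (-β (H(φ) - H(ω)))`. -/
def boltzmann (β p : ℝ) (J : ℕ → ℝ) (Λ : Finset ℤ) (ω : Config) : Measure Config :=
  Measure.sum fun ψ : Λ → ℤ =>
    ENNReal.ofReal (Real.exp (-β * energyDiff p J (glue Λ ψ ω) ω)) • Measure.dirac (glue Λ ψ ω)

/-- The finite-volume measure `μ_Λ^ω`, i.e. `boltzmann` divided by its total mass (the partition
function). It is the zero measure, hence not a probability measure, if the partition function is
infinite. -/
def finiteVolume (β p : ℝ) (J : ℕ → ℝ) (Λ : Finset ℤ) (ω : Config) : Measure Config :=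
  (boltzmann β p J Λ ω Set.univ)⁻¹ • boltzmann β p J Λ ω

/-- Gibbs measures: probability measures that satisfy the DLR equations
`μ = ∫ μ_Λ^ω dμ(ω)` for all finite `Λ`. The field `summable` says that the energy differences
which define `μ_Λ^ω` are convergent sums for `μ`-almost every boundary condition `ω`. -/
structure IsGibbs (β p : ℝ) (J : ℕ → ℝ) (μ : Measure Config) : Prop where
  isProbabilityMeasure : IsProbabilityMeasure μ
  summable : ∀ Λ : Finset ℤ, ∀ᵐ ω ∂μ, ∀ φ : Config, (∀ i, i ∉ Λ → φ i = ω i) →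
    Summable (energyTerm p J φ ω)
  dlr : ∀ (Λ : Finset ℤ) (A : Set Config), MeasurableSet A →
    μ A = ∫⁻ ω, finiteVolume β p J Λ ω A ∂μ

/-- Translation of a configuration by `v`. -/
def shift (v : ℤ) (φ : Config) : Config := fun i => φ (i + v)

/-- Invariance of a measure under all translations of `ℤ`. -/
def IsShiftInvariant (μ : Measure Config) : Prop :=
  ∀ v : ℤ, μ.map (shift v) = μ

end LongRangeSOS

end

/-! Weak limits inherit the second-moment bound, so it suffices that a shift-invariant Gibbs measure
`μ` cannot have finite second moments (`IsGibbs.lintegral_sq_height_eq_top`). Suppose it does.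
Shifting a whole box by one height changes only the pairs across its boundary. There are `O(d)` such
pairs at distance `d`, and for `p ≤ 2` each changes by `O(|J d|)` times an integrable factor. As `∑
d |J d| < ∞`, the expected cost is bounded uniformly in the box
(`exists_lintegral_loweringCost_le`). Hence `μ` is quasi-invariant under raising boxes, with uniform
constants (`IsGibbs.measureReal_raise_preimage_ge`). By the mean ergodic theorem, the mean heights
on scales `N` and `N'` are both close to one limit `m`. Raising a box of scale `N` moves the first
mean by one and, for `N'` much larger than `N`, barely moves the second. Quasi-invariance would give
this discrepancy a probability bounded below, a contradiction. -/

namespace LongRangeSOS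

/-! ### Quasi-invariance under height translations in a finite set. -/

/-- Add `c` to all heights in `Λ`. -/
def raise (Λ : Finset ℤ) (c : ℤ) (φ : Config) : Config :=
  fun i => if i ∈ Λ then φ i + c else φ i

lemma measurable_raise (Λ : Finset ℤ) (c : ℤ) : Measurable (raise Λ c) := by
  refine measurable_pi_lambda _ fun i => ?_
  unfold raise
  split_ifs <;> fun_prop

lemma raise_glue (Λ : Finset ℤ) (c : ℤ) (ψ : Λ → ℤ) (ω : Config) :
    raise Λ c (glue Λ ψ ω) = glue Λ (fun i => ψ i + c) ω := by
  funext i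
  by_cases h : i ∈ Λ <;> simp [raise, glue, h]

/-- The total absolute energy change when all heights in `Λ` are lowered by one. -/
noncomputable def loweringCost (p : ℝ) (J : ℕ → ℝ) (Λ : Finset ℤ) (φ : Config) : ENNReal :=
  ∑' q : ℤ × ℤ, ENNReal.ofReal |energyTerm p J (raise Λ (-1) φ) φ q|

lemma measurable_V_comp {p : ℝ} {f : Config → ℤ} (hf : Measurable f) :
    Measurable fun φ => V p (f φ) :=
  (measurable_from_top (f := V p)).comp hf

lemma measurable_energyTerm_raise (p : ℝ) (J : ℕ → ℝ) (Λ : Finset ℤ) (c : ℤ) (q : ℤ × ℤ) :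
    Measurable fun φ => energyTerm p J (raise Λ c φ) φ q := by
  have h (i : ℤ) : Measurable fun φ : Config => raise Λ c φ i :=
    (measurable_pi_apply i).comp (measurable_raise Λ c)
  exact ((measurable_V_comp ((h _).sub (h _))).sub
    (measurable_V_comp ((measurable_pi_apply _).sub (measurable_pi_apply _)))).const_mul _

lemma measurable_loweringCost (p : ℝ) (J : ℕ → ℝ) (Λ : Finset ℤ) :
    Measurable (loweringCost p J Λ) :=
  Measurable.tsum fun q => (measurable_energyTerm_raise p J Λ (-1) q).abs.ennreal_ofReal

lemma boltzmann_apply (β p : ℝ) (J : ℕ → ℝ) (Λ : Finset ℤ) (ω : Config) {A : Set Config}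
    (hA : MeasurableSet A) :
    boltzmann β p J Λ ω A = ∑' ψ : Λ → ℤ,
      ENNReal.ofReal (Real.exp (-β * energyDiff p J (glue Λ ψ ω) ω)) *
        A.indicator 1 (glue Λ ψ ω) := by
  simp [boltzmann, Measure.sum_apply _ hA, Measure.dirac_apply' _ hA]

/-- Energy differences form a cocycle: term by term, the boundary condition `ω` cancels and leaves
the difference between the lowered `φ` and `φ`. -/
lemma energyDiff_raise_le {p : ℝ} {J : ℕ → ℝ} {Λ : Finset ℤ} {φ ω : Config} {M : ℝ}
    (hM : 0 ≤ M) (h₁ : Summable (energyTerm p J φ ω))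
    (h₂ : Summable (energyTerm p J (raise Λ (-1) φ) ω))
    (hcost : loweringCost p J Λ φ ≤ ENNReal.ofReal M) :
    energyDiff p J (raise Λ (-1) φ) ω ≤ energyDiff p J φ ω + M := by
  have hterm : energyTerm p J (raise Λ (-1) φ) φ =
      fun q => energyTerm p J (raise Λ (-1) φ) ω q - energyTerm p J φ ω q := by
    funext q; simp only [energyTerm]; ring
  have hs : Summable (energyTerm p J (raise Λ (-1) φ) φ) := hterm ▸ h₂.sub h₁
  have hsub : energyDiff p J (raise Λ (-1) φ) ω - energyDiff p J φ ω =
      ∑' q, energyTerm p J (raise Λ (-1) φ) φ q := by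
    rw [hterm, h₂.tsum_sub h₁]; rfl
  have habs : ∑' q, |energyTerm p J (raise Λ (-1) φ) φ q| ≤ M := by
    rw [loweringCost, ← ENNReal.ofReal_tsum_of_nonneg (fun _ => abs_nonneg _) hs.abs] at hcost
    exact (ENNReal.ofReal_le_ofReal_iff hM).1 hcost
  have hle := hs.tsum_le_tsum (fun q => le_abs_self _) hs.abs
  linarith

/-- Translating the heights in `Λ` changes the Boltzmann weights by a bounded factor on the event
that the lowering cost is bounded. -/
lemma boltzmann_raise_preimage_ge {β p : ℝ} (hβ : 0 ≤ β) {J : ℕ → ℝ} {Λ : Finset ℤ} {ω : Config}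
    (hω : ∀ φ : Config, (∀ i, i ∉ Λ → φ i = ω i) → Summable (energyTerm p J φ ω))
    {B : Set Config} (hB : MeasurableSet B) {M : ℝ} (hM : 0 ≤ M) :
    ENNReal.ofReal (Real.exp (-β * M)) *
        boltzmann β p J Λ ω (B ∩ {φ | loweringCost p J Λ φ ≤ ENNReal.ofReal M}) ≤
      boltzmann β p J Λ ω (raise Λ 1 ⁻¹' B) := by
  have hcost : MeasurableSet {φ | loweringCost p J Λ φ ≤ ENNReal.ofReal M} :=
    measurableSet_le (measurable_loweringCost p J Λ) measurable_const
  rw [boltzmann_apply β p J Λ ω (hB.inter hcost),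
    boltzmann_apply β p J Λ ω (measurable_raise Λ 1 hB), ← ENNReal.tsum_mul_left]
  -- Reindexing the right-hand sum by `ψ ↦ ψ - 1` pairs each configuration in `B` with its lowered
  -- copy.
  refine le_trans (ENNReal.tsum_le_tsum fun ψ => ?_)
    ((Equiv.addRight (fun _ : Λ => (-1 : ℤ))).tsum_eq _).le
  have hlow : glue Λ (Equiv.addRight (fun _ : Λ => (-1 : ℤ)) ψ) ω = raise Λ (-1) (glue Λ ψ ω) := by
    rw [raise_glue]; rfl
  have hback : raise Λ 1 (raise Λ (-1) (glue Λ ψ ω)) = glue Λ ψ ω := by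
    simp [raise_glue]
  rw [hlow]
  by_cases hmem : glue Λ ψ ω ∈ B ∩ {φ | loweringCost p J Λ φ ≤ ENNReal.ofReal M}
  · have hmem' : raise Λ (-1) (glue Λ ψ ω) ∈ raise Λ 1 ⁻¹' B := by
      rw [Set.mem_preimage, hback]; exact hmem.1
    rw [Set.indicator_of_mem hmem, Set.indicator_of_mem hmem', Pi.one_apply, Pi.one_apply, mul_one,
      mul_one, ← ENNReal.ofReal_mul (Real.exp_pos _).le, ← Real.exp_add]
    refine ENNReal.ofReal_le_ofReal (Real.exp_le_exp.2 ?_)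
    have h₁ := hω (glue Λ ψ ω) fun i hi => by simp [glue, hi]
    have h₂ := hω (raise Λ (-1) (glue Λ ψ ω)) fun i hi => by simp [raise, glue, hi]
    have := mul_le_mul_of_nonneg_left (energyDiff_raise_le hM h₁ h₂ hmem.2) hβ
    linarith
  · simp [Set.indicator_of_notMem hmem]

/-- Quasi-invariance of Gibbs measures under translation of the heights in a finite set. -/
lemma IsGibbs.raise_preimage_ge {β p : ℝ} (hβ : 0 ≤ β) {J : ℕ → ℝ} {μ : Measure Config}
    (hμ : IsGibbs β p J μ) (Λ : Finset ℤ) {B : Set Config} (hB : MeasurableSet B)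
    {M : ℝ} (hM : 0 ≤ M) :
    ENNReal.ofReal (Real.exp (-β * M)) *
        μ (B ∩ {φ | loweringCost p J Λ φ ≤ ENNReal.ofReal M}) ≤ μ (raise Λ 1 ⁻¹' B) := by
  have hcost : MeasurableSet {φ | loweringCost p J Λ φ ≤ ENNReal.ofReal M} :=
    measurableSet_le (measurable_loweringCost p J Λ) measurable_const
  rw [hμ.dlr Λ _ (hB.inter hcost), hμ.dlr Λ _ (measurable_raise Λ 1 hB),
    ← lintegral_const_mul' _ _ ENNReal.ofReal_ne_top]
  refine lintegral_mono_ae ?_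
  filter_upwards [hμ.summable Λ] with ω hω
  -- Both sides carry the same normalising factor, so the unnormalised weights can be compared.
  simp only [finiteVolume, Measure.smul_apply, smul_eq_mul]
  rw [mul_left_comm]
  gcongr
  exact boltzmann_raise_preimage_ge hβ hω hB hM

/-- Quasi-invariance, with the exceptional event estimated by Markov's inequality. -/
lemma IsGibbs.measureReal_raise_preimage_ge {β p : ℝ} (hβ : 0 ≤ β) {J : ℕ → ℝ}
    {μ : Measure Config} (hμ : IsGibbs β p J μ) (Λ : Finset ℤ) {B : Set Config}
    (hB : MeasurableSet B) {K : ℝ} (hK : 0 ≤ K)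
    (hcost : ∫⁻ φ, loweringCost p J Λ φ ∂μ ≤ ENNReal.ofReal K) {M : ℝ} (hM : 0 < M) :
    Real.exp (-β * M) * (μ.real B - K / M) ≤ μ.real (raise Λ 1 ⁻¹' B) := by
  have := hμ.isProbabilityMeasure
  have hmarkov : μ.real {φ | ENNReal.ofReal M ≤ loweringCost p J Λ φ} ≤ K / M := by
    refine ENNReal.toReal_le_of_le_ofReal (by positivity) ?_
    rw [ENNReal.ofReal_div_of_pos hM]
    exact (meas_ge_le_lintegral_div (measurable_loweringCost p J Λ).aemeasurable (by simpa using hM)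
      ENNReal.ofReal_ne_top).trans (ENNReal.div_le_div_right hcost _)
  have hsplit : μ.real B ≤ μ.real (B ∩ {φ | loweringCost p J Λ φ ≤ ENNReal.ofReal M}) +
      μ.real {φ | ENNReal.ofReal M ≤ loweringCost p J Λ φ} := by
    refine (measureReal_mono fun φ hφ => ?_).trans (measureReal_union_le _ _)
    rcases le_total (loweringCost p J Λ φ) (ENNReal.ofReal M) with h | h
    · exact Or.inl ⟨hφ, h⟩
    · exact Or.inr h
  have hquasi := ENNReal.toReal_mono (measure_ne_top _ _) (hμ.raise_preimage_ge hβ Λ hB hM.le)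
  rw [ENNReal.toReal_mul, ENNReal.toReal_ofReal (Real.exp_pos _).le] at hquasi
  refine le_trans ?_ hquasi
  exact mul_le_mul_of_nonneg_left (by simp only [measureReal_def] at *; linarith)
    (Real.exp_pos _).le

end LongRangeSOS

/-! ### Ergodic averages and mean heights. -/

/-- The mean ergodic theorem for square-integrable functions, in the form of convergence in
measure of the Birkhoff averages. -/
lemma MeasureTheory.MeasurePreserving.exists_tendstoInMeasure_birkhoffAverage {X : Type*}
    [MeasurableSpace X] {μ : Measure X} {T : X → X} (hT : MeasurePreserving T μ μ) {f : X → ℝ}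
    (hf : MemLp f 2 μ) :
    ∃ m : X → ℝ, TendstoInMeasure μ (fun N => birkhoffAverage ℝ T f N) atTop m := by
  -- Von Neumann's theorem for the Koopman isometry; the limit is the projection onto the invariant
  -- vectors.
  let U : Lp ℝ 2 μ →L[ℝ] Lp ℝ 2 μ :=
    (Lp.compMeasurePreservingₗᵢ (p := 2) (E := ℝ) ℝ T hT).toContinuousLinearMap
  have hU : ‖U‖ ≤ 1 := LinearIsometry.norm_toContinuousLinearMap_le _
  have hiter (k : ℕ) : (U^[k] (hf.toLp f) : X → ℝ) =ᵐ[μ] fun x => f (T^[k] x) := by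
    induction k with
    | zero => exact hf.coeFn_toLp
    | succ k ih =>
      rw [Function.iterate_succ_apply']
      refine (Lp.coeFn_compMeasurePreserving (U^[k] (hf.toLp f)) hT).trans ?_
      filter_upwards [hT.quasiMeasurePreserving.ae_eq_comp ih] with x hx
      rw [hx, Function.comp_apply, ← Function.iterate_succ_apply]
  have hlim := tendstoInMeasure_of_tendsto_Lp
    (U.tendsto_birkhoffAverage_orthogonalProjection hU (hf.toLp f))
  refine ⟨_, hlim.congr_left fun N => ?_⟩
  have hsum : ∀ N : ℕ, ((birkhoffSum U id N (hf.toLp f) : Lp ℝ 2 μ) : X → ℝ) =ᵐ[μ] birkhoffSum T f N := by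
    intro N
    induction N with
    | zero => simpa using Lp.coeFn_zero ℝ 2 μ
    | succ N ih =>
      rw [birkhoffSum_succ]
      filter_upwards [Lp.coeFn_add (birkhoffSum U id N (hf.toLp f)) (id (U^[N] (hf.toLp f))), ih,
        hiter N] with x h₁ h₂ h₃
      rw [h₁, Pi.add_apply, h₂, id, h₃, birkhoffSum_succ]
  filter_upwards [Lp.coeFn_smul ((N : ℝ)⁻¹) (birkhoffSum U id N (hf.toLp f)), hsum N] with x h₁ h₂
  rw [birkhoffAverage, h₁, Pi.smul_apply, h₂, birkhoffAverage]

namespace LongRangeSOS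

lemma IsShiftInvariant.measurePreserving {μ : Measure Config} (hμ : IsShiftInvariant μ) (v : ℤ) :
    MeasurePreserving (shift v) μ μ :=
  ⟨measurable_pi_lambda _ fun _ => measurable_pi_apply _, hμ v⟩

/-- The mean height over the sites `0, …, N - 1`. -/
noncomputable def meanHeight (N : ℕ) (φ : Config) : ℝ :=
  (∑ i ∈ Finset.range N, (φ (i : ℤ) : ℝ)) / N

lemma measurable_intCast_apply (i : ℤ) : Measurable fun φ : Config => (φ i : ℝ) :=
  (measurable_from_top (f := fun k : ℤ => (k : ℝ))).comp (measurable_pi_apply i)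

lemma measurable_meanHeight (N : ℕ) : Measurable (meanHeight N) :=
  (Finset.measurable_sum (Finset.range N) fun i _ => measurable_intCast_apply (i : ℤ)).div_const _

lemma birkhoffAverage_shift (N : ℕ) :
    birkhoffAverage ℝ (shift 1) (fun φ : Config => (φ 0 : ℝ)) N = meanHeight N := by
  have hiter (k : ℕ) (φ : Config) (i : ℤ) : (shift 1)^[k] φ i = φ (i + k) := by
    induction k generalizing i with
    | zero => simp
    | succ k ih =>
      rw [Function.iterate_succ_apply', shift, ih]
      congr 1; push_cast; ring
  funext φ
  simp [birkhoffAverage, birkhoffSum, meanHeight, hiter, div_eq_inv_mul]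

lemma memLp_height_zero {μ : Measure Config}
    (h : ∫⁻ φ, ENNReal.ofReal ((φ 0 : ℝ) ^ 2) ∂μ ≠ ⊤) :
    MemLp (fun φ : Config => (φ 0 : ℝ)) 2 μ := by
  refine (memLp_two_iff_integrable_sq (measurable_intCast_apply 0).aestronglyMeasurable).2
    ⟨((measurable_intCast_apply 0).pow_const 2).aestronglyMeasurable, ?_⟩
  rw [hasFiniteIntegral_iff_ofReal (Eventually.of_forall fun φ => sq_nonneg _)]
  exact h.lt_top

lemma IsShiftInvariant.lintegral_sq_height {μ : Measure Config} (hμ : IsShiftInvariant μ)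
    (i : ℤ) : ∫⁻ φ, ENNReal.ofReal ((φ i : ℝ) ^ 2) ∂μ =
      ∫⁻ φ, ENNReal.ofReal ((φ 0 : ℝ) ^ 2) ∂μ := by
  rw [← (hμ.measurePreserving i).lintegral_comp
    ((measurable_intCast_apply 0).pow_const 2).ennreal_ofReal]
  simp [shift]

lemma meanHeight_raise {N n : ℕ} (hN : 0 < N) (hn : N ≤ n) (φ : Config) :
    meanHeight N (raise (Finset.Icc (-n) n) 1 φ) = meanHeight N φ + 1 := by
  have h : ∀ i ∈ Finset.range N,
      (raise (Finset.Icc (-n) n) 1 φ (i : ℤ) : ℝ) = φ (i : ℤ) + 1 := by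
    intro i hi
    have : (i : ℤ) ∈ Finset.Icc (-n : ℤ) n := by
      rw [Finset.mem_range] at hi; rw [Finset.mem_Icc]; omega
    simp [raise, this]
  have hN' : (N : ℝ) ≠ 0 := by positivity
  rw [meanHeight, Finset.sum_congr rfl h, Finset.sum_add_distrib, meanHeight]
  field_simp
  simp

/-- At most `Λ.card` summands change, so the effect vanishes as `N → ∞` with `Λ` fixed. -/
lemma meanHeight_raise_le (N : ℕ) (Λ : Finset ℤ) (φ : Config) :
    meanHeight N (raise Λ 1 φ) ≤ meanHeight N φ + (Λ.card : ℝ) / N := by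
  have h (i : ℤ) : (raise Λ 1 φ i : ℝ) = φ i + if i ∈ Λ then 1 else 0 := by
    by_cases hi : i ∈ Λ <;> simp [raise, hi]
  simp only [meanHeight, h, Finset.sum_add_distrib, add_div]
  gcongr
  rw [Finset.sum_boole]
  exact_mod_cast Finset.card_le_card_of_injOn (fun i : ℕ => (i : ℤ))
    (fun i hi => by simpa using (Finset.mem_filter.1 hi).2) (Nat.cast_injective.injOn)

end LongRangeSOS

/-! ### Uniform bound on the expected cost of lowering a box. -/

/-- Bernoulli's inequality at `b / a` gives `a ^ p - b ^ p ≤ p (a - b) a ^ (p - 1)`; then `p ≤ 2`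
and `1 ≤ a` give `a ^ (p - 1) ≤ a`. -/
lemma Real.rpow_sub_rpow_le_of_le_add_one {p a b : ℝ} (hp₁ : 1 ≤ p) (hp₂ : p ≤ 2) (ha : 1 ≤ a)
    (hb : 0 ≤ b) (hab : a ≤ b + 1) : a ^ p - b ^ p ≤ 2 * a := by
  have ha₀ : 0 < a := by linarith
  have hber := one_add_mul_self_le_rpow_one_add (s := b / a - 1) (by
    have : 0 ≤ b / a := by positivity
    linarith) hp₁
  rw [add_sub_cancel, Real.div_rpow hb ha₀.le, le_div_iff₀ (by positivity)] at hber
  have hpow : a ^ p = a ^ (p - 1) * a := by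
    rw [← Real.rpow_add_one ha₀.ne']; congr 1; ring
  have hle : a ^ (p - 1) ≤ a := by
    simpa using Real.rpow_le_rpow_of_exponent_le ha (show p - 1 ≤ 1 by linarith)
  have hpos : 0 ≤ a ^ (p - 1) := by positivity
  have : (1 + p * (b / a - 1)) * a ^ p = a ^ p - p * (a - b) * a ^ (p - 1) := by
    rw [hpow]; field_simp; ring
  have hprod : p * (a - b) * a ^ (p - 1) ≤ 2 * a :=
    mul_le_mul (by nlinarith) hle hpos (by norm_num)
  linarith

namespace LongRangeSOS

lemma abs_V_sub_V_le {p : ℝ} (hp₁ : 1 ≤ p) (hp₂ : p ≤ 2) {x y : ℤ} (hxy : |x - y| ≤ 1) :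
    |V p x - V p y| ≤ 2 * (1 + |(y : ℝ)|) := by
  have key {u v : ℤ} (h : |u - v| ≤ 1) (huv : |v| ≤ |u|) :
      0 ≤ V p u - V p v ∧ V p u - V p v ≤ 2 * |(u : ℝ)| := by
    have huv' : |(v : ℝ)| ≤ |(u : ℝ)| := by exact_mod_cast huv
    have h' : |(u : ℝ)| ≤ |(v : ℝ)| + 1 := by
      have : |u| ≤ |v| + 1 := by
        have := abs_sub_abs_le_abs_sub u v; linarith
      exact_mod_cast this
    refine ⟨sub_nonneg.2 (Real.rpow_le_rpow (abs_nonneg _) huv' (by linarith)), ?_⟩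
    rcases eq_or_ne u 0 with rfl | hu
    · have : v = 0 := by simpa using huv
      simp [this]
    · refine Real.rpow_sub_rpow_le_of_le_add_one hp₁ hp₂ ?_ (abs_nonneg _) h'
      exact_mod_cast Int.one_le_abs hu
  rcases le_total |y| |x| with h | h
  · obtain ⟨h₀, h₁⟩ := key hxy h
    have : |(x : ℝ)| ≤ |(y : ℝ)| + 1 := by
      have : |x| ≤ |y| + 1 := by
        have := abs_sub_abs_le_abs_sub x y; linarith
      exact_mod_cast this
    rw [abs_of_nonneg h₀]; linarith
  · obtain ⟨h₀, h₁⟩ := key (abs_sub_comm x y ▸ hxy) h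
    rw [abs_sub_comm, abs_of_nonneg h₀]; linarith

lemma abs_intCast_le_sq (k : ℤ) : |(k : ℝ)| ≤ (k : ℝ) ^ 2 := by
  rw [← sq_abs (k : ℝ)]
  exact_mod_cast Int.le_self_sq |k|

/-- Only pairs with exactly one site in `Λ` contribute to the lowering cost. -/
lemma ofReal_abs_energyTerm_raise_le {p : ℝ} (hp₁ : 1 ≤ p) (hp₂ : p ≤ 2) (J : ℕ → ℝ)
    (Λ : Finset ℤ) (φ : Config) (i j : ℤ) :
    ENNReal.ofReal |energyTerm p J (raise Λ (-1) φ) φ (i, j)| ≤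
      (if (i ∈ Λ ↔ j ∈ Λ) then 0 else ENNReal.ofReal |J (i - j).natAbs|) *
        (2 * (1 + (ENNReal.ofReal ((φ i : ℝ) ^ 2) + ENNReal.ofReal ((φ j : ℝ) ^ 2)))) := by
  split_ifs with h
  · have : raise Λ (-1) φ i - raise Λ (-1) φ j = φ i - φ j := by
      by_cases hi : i ∈ Λ <;> simp [raise, hi, ← h]
    simp [energyTerm, this]
  · have hd : |(raise Λ (-1) φ i - raise Λ (-1) φ j) - (φ i - φ j)| ≤ 1 := by
      by_cases hi : i ∈ Λ <;> by_cases hj : j ∈ Λ <;> simp [raise, hi, hj] at h ⊢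
    have hV := abs_V_sub_V_le hp₁ hp₂ hd
    have hx : |((φ i - φ j : ℤ) : ℝ)| ≤ (φ i : ℝ) ^ 2 + (φ j : ℝ) ^ 2 := by
      push_cast
      exact (abs_sub _ _).trans (add_le_add (abs_intCast_le_sq _) (abs_intCast_le_sq _))
    have : 2 * (1 + (ENNReal.ofReal ((φ i : ℝ) ^ 2) + ENNReal.ofReal ((φ j : ℝ) ^ 2))) =
        ENNReal.ofReal (2 * (1 + ((φ i : ℝ) ^ 2 + (φ j : ℝ) ^ 2))) := by
      rw [ENNReal.ofReal_mul (by norm_num), ENNReal.ofReal_add (by norm_num) (by positivity),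
        ENNReal.ofReal_add (by positivity) (by positivity)]
      simp
    rw [this, ← ENNReal.ofReal_mul (abs_nonneg _)]
    refine ENNReal.ofReal_le_ofReal ?_
    simp only [energyTerm, abs_mul]
    refine mul_le_mul_of_nonneg_left ?_ (abs_nonneg _)
    linarith

/-- A translation by `d` moves at most `4 |d|` sites across the boundary of an interval. -/
lemma tsum_boundary_translate_le (n : ℕ) (d : ℤ) (a : ENNReal) :
    ∑' i : ℤ, (if (i ∈ Finset.Icc (-n : ℤ) n ↔ i + d ∈ Finset.Icc (-n : ℤ) n) then 0 else a) ≤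
      4 * (d.natAbs * a) := by
  -- Windows of radius `|d|` about the two endpoints, half-open so that each has exactly `2 |d|`
  -- sites.
  let S : Finset ℤ := Finset.Ioc (n - d.natAbs) (n + d.natAbs) ∪
    Finset.Ico (-n - d.natAbs) (-n + d.natAbs)
  have hcard : S.card ≤ 4 * d.natAbs := by
    refine (Finset.card_union_le _ _).trans ?_
    rw [Int.card_Ioc, Int.card_Ico]
    omega
  rw [tsum_eq_sum (s := S)]
  · calc _ ≤ ∑ _i ∈ S, a := Finset.sum_le_sum fun i _ => by split_ifs <;> simp
      _ = S.card * a := by simp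
      _ ≤ (4 * d.natAbs : ℕ) * a := by gcongr
      _ = _ := by push_cast; ring
  · intro i hi
    rw [if_pos]
    simp only [S, Finset.mem_union, Finset.mem_Ioc, Finset.mem_Ico, not_or] at hi
    simp only [Finset.mem_Icc]
    omega

/-- The weight `|d|` counts boundary-crossing pairs at displacement `d`; summability is where `α >
2` enters. -/
lemma summable_natAbs_mul_abs {α : ℝ} (hα : 2 < α) {J : ℕ → ℝ}
    (hJ : J =O[atTop] fun k : ℕ => (k : ℝ) ^ (-α)) :
    Summable fun d : ℤ => (d.natAbs : ℝ) * |J d.natAbs| := by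
  have hnat : Summable fun k : ℕ => (k : ℝ) * |J k| := by
    refine summable_of_isBigO_nat (Real.summable_nat_rpow.2 (show 1 + -α < -1 by linarith)) ?_
    have h := (isBigO_refl (fun k : ℕ => (k : ℝ)) atTop).mul hJ.abs_left
    refine h.congr' EventuallyEq.rfl ?_
    filter_upwards [eventually_gt_atTop 0] with k hk
    rw [Real.rpow_add (by exact_mod_cast hk), Real.rpow_one]
  exact Summable.of_nat_of_neg (by simpa using hnat) (by simpa using hnat)

/-- The expected lowering cost is bounded uniformly over boxes. -/
lemma exists_lintegral_loweringCost_le {p : ℝ} (hp₁ : 1 ≤ p) (hp₂ : p ≤ 2) {α : ℝ} (hα : 2 < α)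
    {J : ℕ → ℝ} (hJ : J =O[atTop] fun k : ℕ => (k : ℝ) ^ (-α)) {μ : Measure Config}
    [IsProbabilityMeasure μ] {C : ENNReal} (hC : C ≠ ⊤)
    (hsq : ∀ i : ℤ, ∫⁻ φ, ENNReal.ofReal ((φ i : ℝ) ^ 2) ∂μ ≤ C) :
    ∃ K : ℝ, 0 ≤ K ∧ ∀ n : ℕ,
      ∫⁻ φ, loweringCost p J (Finset.Icc (-n : ℤ) n) φ ∂μ ≤ ENNReal.ofReal K := by
  let S : ENNReal := ∑' d : ℤ, ENNReal.ofReal ((d.natAbs : ℝ) * |J d.natAbs|)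
  have hS : S ≠ ⊤ := (summable_natAbs_mul_abs hα hJ).tsum_ofReal_ne_top
  have hfin : 4 * S * (2 * (1 + (C + C))) ≠ ⊤ := by finiteness
  refine ⟨(4 * S * (2 * (1 + (C + C)))).toReal, ENNReal.toReal_nonneg, fun n => ?_⟩
  rw [ENNReal.ofReal_toReal hfin]
  have hmeas (i : ℤ) : Measurable fun φ : Config => ENNReal.ofReal ((φ i : ℝ) ^ 2) :=
    ((measurable_intCast_apply i).pow_const 2).ennreal_ofReal
  have hterm (i j : ℤ) :
      ∫⁻ φ, ENNReal.ofReal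
        |energyTerm p J (raise (Finset.Icc (-n : ℤ) n) (-1) φ) φ (i, j)| ∂μ ≤
      (if (i ∈ Finset.Icc (-n : ℤ) n ↔ j ∈ Finset.Icc (-n : ℤ) n) then 0
        else ENNReal.ofReal |J (i - j).natAbs|) * (2 * (1 + (C + C))) := by
    refine (lintegral_mono fun φ => ofReal_abs_energyTerm_raise_le hp₁ hp₂ J _ φ i j).trans ?_
    rw [lintegral_const_mul _ (by fun_prop), lintegral_const_mul _ (by fun_prop),
      lintegral_add_left measurable_const, lintegral_add_left (hmeas i), lintegral_const,
      measure_univ, mul_one]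
    gcongr <;> exact hsq _
  simp only [loweringCost]
  rw [lintegral_tsum fun q =>
      (measurable_energyTerm_raise p J _ (-1) q).abs.ennreal_ofReal.aemeasurable,
    ENNReal.tsum_prod']
  calc _ ≤ ∑' (i : ℤ) (j : ℤ), (if (i ∈ Finset.Icc (-n : ℤ) n ↔ j ∈ Finset.Icc (-n : ℤ) n) then 0
        else ENNReal.ofReal |J (i - j).natAbs|) * (2 * (1 + (C + C))) :=
        ENNReal.tsum_le_tsum fun i => ENNReal.tsum_le_tsum fun j => hterm i j
    _ = (∑' (i : ℤ) (d : ℤ), (if (i ∈ Finset.Icc (-n : ℤ) n ↔ i + d ∈ Finset.Icc (-n : ℤ) n) then 0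
        else ENNReal.ofReal |J d.natAbs|)) * (2 * (1 + (C + C))) := by
      simp_rw [ENNReal.tsum_mul_right]
      congr 1
      refine tsum_congr fun i => ?_
      -- Substituting `j = i + d` makes the coupling depend on `d` alone, so that `i` can be summed
      -- first.
      rw [← (Equiv.addLeft i).tsum_eq]
      simp
    _ ≤ 4 * S * (2 * (1 + (C + C))) := by
      rw [ENNReal.tsum_comm]
      gcongr
      rw [← ENNReal.tsum_mul_left]
      refine ENNReal.tsum_le_tsum fun d => (tsum_boundary_translate_le n d _).trans_eq ?_
      rw [ENNReal.ofReal_mul (Nat.cast_nonneg _), ENNReal.ofReal_natCast]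

/-! ### Passage to the limit and the contradiction. -/

/-- The integrand is continuous, nonnegative and unbounded, so its integral is lower semicontinuous
under weak convergence (portmanteau on open sets). -/
lemma lintegral_sq_height_le_of_tendsto {ν : ℕ → ProbabilityMeasure Config}
    {μ : ProbabilityMeasure Config} (hν : Tendsto ν atTop (𝓝 μ)) {C : ENNReal}
    (hC : ∀ n, ∫⁻ φ, ENNReal.ofReal ((φ 0 : ℝ) ^ 2) ∂(ν n : Measure Config) ≤ C) :
    ∫⁻ φ, ENNReal.ofReal ((φ 0 : ℝ) ^ 2) ∂(μ : Measure Config) ≤ C := by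
  have hcont : Continuous fun φ : Config => (φ 0 : ℝ) ^ 2 :=
    ((continuous_of_discreteTopology (f := fun k : ℤ => (k : ℝ))).comp (continuous_apply 0)).pow 2
  refine (lintegral_le_liminf_lintegral_of_forall_isOpen_measure_le_liminf_measure
    hcont (fun φ => sq_nonneg _) fun G hG =>
      ProbabilityMeasure.le_liminf_measure_open_of_tendsto hν hG).trans ?_
  exact liminf_le_of_frequently_le' (Frequently.of_forall hC)

/-- Any real function charges some interval of length `1 / 4`. -/
lemma exists_measureReal_quarter_interval_pos {X : Type*} [MeasurableSpace X] (μ : Measure X)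
    [IsProbabilityMeasure μ] (m : X → ℝ) :
    ∃ a : ℝ, 0 < μ.real {x | a ≤ m x ∧ m x < a + 1 / 4} := by
  by_contra! h
  have hnull (k : ℤ) : μ {x | (k : ℝ) / 4 ≤ m x ∧ m x < (k : ℝ) / 4 + 1 / 4} = 0 :=
    (measureReal_eq_zero_iff).1 (le_antisymm (h _) measureReal_nonneg)
  have huniv : (⋃ k : ℤ, {x | (k : ℝ) / 4 ≤ m x ∧ m x < (k : ℝ) / 4 + 1 / 4}) = Set.univ := by
    refine Set.eq_univ_of_forall fun x => Set.mem_iUnion.2 ⟨⌊4 * m x⌋, ?_⟩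
    have h₁ := Int.floor_le (4 * m x)
    have h₂ := Int.lt_floor_add_one (4 * m x)
    constructor <;> linarith
  have := measure_iUnion_null hnull
  rw [huniv, measure_univ] at this
  exact one_ne_zero this

/-- For `p ∈ [1, 2]` and couplings of decay `α > 2`, no shift-invariant Gibbs measure has finite
second moments. -/
theorem IsGibbs.lintegral_sq_height_eq_top {p : ℝ} (hp₁ : 1 ≤ p) (hp₂ : p ≤ 2) {α : ℝ}
    (hα : 2 < α) {β : ℝ} (hβ : 0 ≤ β) {J : ℕ → ℝ}
    (hJ : J =O[atTop] fun k : ℕ => (k : ℝ) ^ (-α)) {μ : Measure Config} (hμ : IsGibbs β p J μ)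
    (hinv : IsShiftInvariant μ) :
    ∫⁻ φ, ENNReal.ofReal ((φ 0 : ℝ) ^ 2) ∂μ = ⊤ := by
  by_contra hfin
  have := hμ.isProbabilityMeasure
  obtain ⟨K, hK, hcost⟩ := exists_lintegral_loweringCost_le hp₁ hp₂ hα hJ hfin
    fun i => (hinv.lintegral_sq_height i).le
  obtain ⟨m, hm⟩ := (hinv.measurePreserving 1).exists_tendstoInMeasure_birkhoffAverage
    (memLp_height_zero hfin)
  simp only [birkhoffAverage_shift] at hm
  obtain ⟨a, ha⟩ := exists_measureReal_quarter_interval_pos μ m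
  set c := μ.real {x | a ≤ m x ∧ m x < a + 1 / 4}
  -- This makes the Markov error `K / M` at most `c / 4`; the `+ 1` keeps `M` positive when `K = 0`.
  let M : ℝ := 4 * (K + 1) / c
  have hM : 0 < M := by positivity
  have hKM : K / M ≤ c / 4 := by
    rw [div_le_iff₀ hM]
    simp only [M]; field_simp; linarith
  -- Two exceptional events cost `2 * ε = exp (-β * M) * c / 4`, half of the lower bound `exp (-β *
  -- M) * c / 2` that quasi-invariance will give.
  let ε : ℝ := Real.exp (-β * M) * (c / 8)
  have hε : 0 < ε := by positivity
  have hexp : Real.exp (-β * M) ≤ 1 := Real.exp_le_one_iff.2 (by nlinarith)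
  have hεc : ε ≤ c / 8 := by simp only [ε]; nlinarith
  have hclose : ∀ᶠ N in atTop, μ.real {φ | 1 / 16 ≤ ‖meanHeight N φ - m φ‖} ≤ ε :=
    (tendstoInMeasure_iff_measureReal_norm.1 hm (1 / 16) (by norm_num)).eventually_le_const hε
  obtain ⟨N, hN, hN₀⟩ := (hclose.and (eventually_gt_atTop 0)).exists
  have hsmall : ∀ᶠ N' : ℕ in atTop, ((Finset.Icc (-N : ℤ) N).card : ℝ) / N' ≤ 1 / 8 :=
    (tendsto_const_div_atTop_nhds_zero_nat _).eventually_le_const (by norm_num)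
  obtain ⟨N', hN', hsmall⟩ := (hclose.and hsmall).exists
  let B : Set Config := {φ | a - 1 / 4 < meanHeight N' φ ∧ meanHeight N φ < a + 1 / 2}
  have hB : MeasurableSet B :=
    (measurableSet_lt measurable_const (measurable_meanHeight N')).inter
      (measurableSet_lt (measurable_meanHeight N) measurable_const)
  let D (k : ℕ) : Set Config := {φ | 1 / 16 ≤ ‖meanHeight k φ - m φ‖}
  have hnotD {k : ℕ} {φ : Config} (h : φ ∉ D k) :
      -(1 / 16) < meanHeight k φ - m φ ∧ meanHeight k φ - m φ < 1 / 16 :=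
    abs_lt.1 (not_le.1 h)
  have hlower : c ≤ μ.real B + (μ.real (D N) + μ.real (D N')) := by
    refine (measureReal_mono (s₂ := B ∪ (D N ∪ D N')) fun φ hφ => ?_).trans
      ((measureReal_union_le _ _).trans (by gcongr; exact measureReal_union_le _ _))
    by_contra hφ'
    simp only [Set.mem_union, not_or] at hφ'
    obtain ⟨hφB, hφN, hφN'⟩ := hφ'
    have h₁ := hnotD hφN
    have h₂ := hnotD hφN'
    obtain ⟨h₃, h₄⟩ := hφ
    exact hφB ⟨by linarith, by linarith⟩
  -- On the preimage the `N`-mean is below `a - 1/2` and the `N'`-mean above `a - 1/4 - 1/8`. The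
  -- gap `1/8` cannot occur if both are within `1/16` of `m`.
  have hupper : μ.real (raise (Finset.Icc (-N : ℤ) N) 1 ⁻¹' B) ≤
      μ.real (D N) + μ.real (D N') := by
    refine (measureReal_mono (s₂ := D N ∪ D N') fun φ hφ => ?_).trans (measureReal_union_le _ _)
    by_contra hφ'
    simp only [Set.mem_union, not_or] at hφ'
    have h₁ := hnotD hφ'.1
    have h₂ := hnotD hφ'.2
    obtain ⟨h₃, h₄⟩ := hφ
    rw [meanHeight_raise hN₀ le_rfl] at h₄
    have h₅ := meanHeight_raise_le N' (Finset.Icc (-N : ℤ) N) φ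
    linarith
  have hquasi := hμ.measureReal_raise_preimage_ge hβ (Finset.Icc (-N : ℤ) N) hB hK (hcost N) hM
  have hBc : c / 2 ≤ μ.real B - K / M := by
    simp only [D] at hlower; linarith
  have := mul_le_mul_of_nonneg_left hBc (Real.exp_pos (-β * M)).le
  have hpos : 0 < Real.exp (-β * M) * c := by positivity
  simp only [D, ε] at *
  linarith

end LongRangeSOS

theorem corollary2 (p : ℝ) (hp : 1 ≤ p ∧ p ≤ 2) (α : ℝ) (hα : 2 < α) (β : ℝ) (hβ : 0 < β)
    (J : ℕ → ℝ) (hJ : J =O[atTop] fun k : ℕ => (k : ℝ) ^ (-α)) :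
    ¬ ∃ Λ : ℕ → Finset ℤ,
      Monotone Λ ∧ (∀ i : ℤ, ∃ n, i ∈ Λ n) ∧
      (∃ C : ℝ, ∀ n, ∫⁻ φ, ENNReal.ofReal ((φ 0 : ℝ) ^ 2)
        ∂(LongRangeSOS.finiteVolume β p J (Λ n) 0) < ENNReal.ofReal C) ∧
      ∃ (hΛ : ∀ n, IsProbabilityMeasure (LongRangeSOS.finiteVolume β p J (Λ n) 0))
        (μ : ProbabilityMeasure LongRangeSOS.Config),
        Tendsto (β := ProbabilityMeasure LongRangeSOS.Config)
          (fun n => ⟨LongRangeSOS.finiteVolume β p J (Λ n) 0, hΛ n⟩) atTop (𝓝 μ) ∧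
        LongRangeSOS.IsGibbs β p J (μ : Measure LongRangeSOS.Config) ∧
        LongRangeSOS.IsShiftInvariant (μ : Measure LongRangeSOS.Config) := by
  rintro ⟨Λ, -, -, ⟨C, hC⟩, hΛ, μ, hμ, hgibbs, hinv⟩
  have hle := LongRangeSOS.lintegral_sq_height_le_of_tendsto hμ fun n => (hC n).le
  rw [hgibbs.lintegral_sq_height_eq_top hp.1 hp.2 hα hβ.le hJ hinv] at hle
  exact ENNReal.ofReal_ne_top (top_le_iff.1 hle)
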